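/- Let $q$ be a prime power. Let $E(q,n)$ be the set of all subspaces of $\mathrm{GF}(q)^n$ and $E_r(q,n)$ the set of those of dimension $r$. For $U,V\in E(q,n)$ let $d_S(U,V)=\dim(U+V)-\dim(U\cap V)$ be the subspace distance and $d_I(U,V)=\max\{\dim U,\dim V\}-\dim(U\cap V)$ the injection distance (so $d_I=\tfrac12 d_S$ on $E_r(q,n)$). Let $A_S(q,n,d)$ be the maximum cardinality of a nonempty subset of $E(q,n)$ any two distinct members of which have subspace distance at least $d$, and, for $0\le r\le n$, let $A_C(q,n,r,d)$ be the maximum cardinality of a nonempty subset of $E_r(q,n)$ (a constant-dimension code, CDC) any two distinct members of which have injection distance at least $d$. For $0\le d'\le 1$ and $0\le r'\le 1$ put $$a_S(d')=\limsup_{n\to\infty}\frac{\log_q A_S(q,n,\lceil nd'\rceil)}{\log_q|E(q,n)|},\qquad a_S(r',d')=\limsup_{n\to\infty,\ n\in N}\frac{\log_q A_C(q,n,r_n,\lceil nd'/2\rceil)}{\log_q|E(q,n)|},$$ where $N$ is any infinite set of positive integers and $r_n$ $(n\in N)$ are any integers with $0\le r_n\le n$ and $r_n/n\to r'$ as $n\to\infty$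 in $N$. (For example, $N$ is the set of all $n$ for which $nr'$ is an integer and $r_n=nr'$, when $r'$ is rational; or $N$ is the set of all positive integers and $r_n=\lfloor nr'\rfloor$, for any real $r'$.) Then, for all $0\le d'\le 1$: 1. $a_S(d')=1-d'$. 2. For every choice of $N$ and $(r_n)$ as above, - $a_S(r',d')=0$ if $0\le r'\le \frac{d'}2$ or $1-\frac{d'}2\le r'\le 1$; - $a_S(r',d')=2(1-r')(2r'-d')$ if $\frac{d'}2\le r'\le\frac12$; - $a_S(r',d')=2r'(2-2r'-d')$ if $\frac12\le r'\le 1-\frac{d'}2$. -/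

import Mathlib

open Filter Topology

namespace SubspaceCode

variable {F : Type*} [Field F] {n : ℕ}

/-- The subspace distance `dim (U + V) - dim (U ∩ V)`; the subtraction never truncates. -/
noncomputable def subspaceDist (U V : Submodule F (Fin n → F)) : ℕ :=
  Module.finrank F ↥(U ⊔ V) - Module.finrank F ↥(U ⊓ V)

/-- The injection distance `max (dim U) (dim V) - dim (U ∩ V)`; the subtraction never truncates. -/
noncomputable def injectionDist (U V : Submodule F (Fin n → F)) : ℕ :=
  max (Module.finrank F U) (Module.finrank F V) - Module.finrank F ↥(U ⊓ V)

/-- `C` is a subspace code (a nonempty set of subspaces of `F ^ n`) in which distinct codewords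
have subspace distance at least `d`. -/
def IsCode (d : ℕ) (C : Set (Submodule F (Fin n → F))) : Prop :=
  C.Nonempty ∧ C.Pairwise fun U V => d ≤ subspaceDist U V

/-- `C` is a constant-dimension code (a nonempty set of `r`-dimensional subspaces of `F ^ n`) in
which distinct codewords have injection distance at least `d`. -/
def IsCDC (r d : ℕ) (C : Set (Submodule F (Fin n → F))) : Prop :=
  C.Nonempty ∧ (∀ U ∈ C, Module.finrank F U = r) ∧ C.Pairwise fun U V => d ≤ injectionDist U V

variable (F)

/-- The number `|E(q, n)|` of all subspaces of `F ^ n`. -/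
noncomputable def numSubspaces (n : ℕ) : ℕ :=
  Nat.card (Submodule F (Fin n → F))

/-- `A_S(q, n, d)`: the maximum cardinality of a subspace code in `F ^ n` with minimum subspace
distance (at least) `d`. For finite `F` the supremum is a maximum. -/
noncomputable def maxCode (n d : ℕ) : ℕ :=
  sSup {k | ∃ C : Set (Submodule F (Fin n → F)), IsCode d C ∧ C.ncard = k}

/-- `A_C(q, n, r, d)`: the maximum cardinality of a constant-dimension code of dimension `r` in
`F ^ n` with minimum injection distance (at least) `d`. For finite `F` and `r ≤ n` the supremum
is a maximum. -/
noncomputable def maxCDC (n r d : ℕ) : ℕ :=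
  sSup {k | ∃ C : Set (Submodule F (Fin n → F)), IsCDC r d C ∧ C.ncard = k}

/-- The rate `log_q M / log_q |E(q, n)|` of a code with `M` codewords in `E(q, n)`. -/
noncomputable def rate (n M : ℕ) : ℝ :=
  Real.logb (Nat.card F) M / Real.logb (Nat.card F) (numSubspaces F n)

/-- The asymptotic rate of subspace codes of relative minimum subspace distance `d'`. The upper
limit is taken in the extended reals, so that it is defined without any boundedness proviso. -/
noncomputable def asympRate (d' : ℝ) : EReal :=
  limsup (fun n : ℕ => (rate F n (maxCode F n ⌈(n : ℝ) * d'⌉₊) : EReal)) atTop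

/-- The asymptotic rate of constant-dimension codes of relative minimum subspace distance `d'`,
with the length `n` tending to infinity in the set `N` and with dimension `r n` in length `n`. -/
noncomputable def asympRateCDC (N : Set ℕ) (r : ℕ → ℕ) (d' : ℝ) : EReal :=
  limsup (fun n : ℕ => (rate F n (maxCDC F n (r n) ⌈(n : ℝ) * (d' / 2)⌉₊) : EReal)) (atTop ⊓ 𝓟 N)

end SubspaceCode

/-! All logarithms are of order n^2, so only the quadratic part of each exponent matters. For r ≤
n/2, log_q A_C(q,n,r,d) lies between (n-r)(r-d), from lifted Gabidulin codes (`pow_le_maxCDC`), and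
(n-r+1)(r-d+1) when 1 ≤ d ≤ r, by counting independent tuples (`IsCDC.ncard_le`). Orthogonal
complements exchange r and n-r (`maxCDC_sub`). Dividing by n^2 gives a genuine limit,
`tendsto_logb_maxCDC`.

A subspace code splits into n+1 constant-dimension layers, which costs log_q(n+1) ≤ n, and the bound
for a layer is largest at r = n/2 (`tendsto_logb_maxCode`). The whole lattice is the code with d =
0, so log_q|E(q,n)| ~ n^2/4, and the rates are four times the limits. -/

namespace SubspaceCode

/-! ### Counting bounds, duality and dimension layers -/

section Combinatorics

variable {F : Type*} [Field F]

theorem IsCDC.ncard_le_maxCDC [Finite F] {n r d : ℕ} {C : Set (Submodule F (Fin n → F))}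
    (h : IsCDC r d C) : C.ncard ≤ maxCDC F n r d := by
  refine le_csSup ⟨Nat.card (Submodule F (Fin n → F)), ?_⟩ ⟨C, h, rfl⟩
  rintro _ ⟨D, -, rfl⟩
  exact Set.ncard_le_card D

theorem IsCode.ncard_le_maxCode [Finite F] {n d : ℕ} {C : Set (Submodule F (Fin n → F))}
    (h : IsCode d C) : C.ncard ≤ maxCode F n d := by
  refine le_csSup ⟨Nat.card (Submodule F (Fin n → F)), ?_⟩ ⟨C, h, rfl⟩
  rintro _ ⟨D, -, rfl⟩
  exact Set.ncard_le_card D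

theorem maxCDC_le {n r d B : ℕ}
    (h : ∀ C : Set (Submodule F (Fin n → F)), IsCDC r d C → C.ncard ≤ B) :
    maxCDC F n r d ≤ B := by
  refine csSup_le' ?_
  rintro _ ⟨C, hC, rfl⟩
  exact h C hC

theorem maxCode_le {n d B : ℕ}
    (h : ∀ C : Set (Submodule F (Fin n → F)), IsCode d C → C.ncard ≤ B) :
    maxCode F n d ≤ B := by
  refine csSup_le' ?_
  rintro _ ⟨C, hC, rfl⟩
  exact h C hC

/-- Each factor q^r - q^i of the exact count, with i < r, is at least q^(r-1) because q ≥ 2. -/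
theorem pow_le_card_linearIndependent [Finite F] {V : Type*} [AddCommGroup V] [Module F V]
    [Finite V] {r t : ℕ} (hr : Module.finrank F V = r) (ht : t ≤ r) :
    Nat.card F ^ ((r - 1) * t) ≤ Nat.card {s : Fin t → V // LinearIndependent F s} := by
  have := Fintype.ofFinite F
  rw [card_linearIndependent (by omega), hr, pow_mul, ← Nat.card_eq_fintype_card]
  have hq : 2 ≤ Nat.card F := Finite.one_lt_card
  calc (Nat.card F ^ (r - 1)) ^ t = ∏ _i : Fin t, Nat.card F ^ (r - 1) := by simp
    _ ≤ _ := by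
      refine Finset.prod_le_prod' fun i _ => ?_
      have hi : (i : ℕ) ≤ r - 1 := by omega
      have h1 : Nat.card F ^ (i : ℕ) ≤ Nat.card F ^ (r - 1) := Nat.pow_le_pow_right (by omega) hi
      have h2 : Nat.card F ^ r = Nat.card F ^ (r - 1) * Nat.card F := by
        rw [← pow_succ]; congr 1; omega
      have h3 : Nat.card F ^ (r - 1) * 2 ≤ Nat.card F ^ (r - 1) * Nat.card F :=
        Nat.mul_le_mul_left _ hq
      omega

/-- Every linearly independent `t`-tuple, `t = r - (d - 1)`, lies in at most one codeword. -/
theorem IsCDC.ncard_le [Finite F] {n r d : ℕ} {C : Set (Submodule F (Fin n → F))}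
    (h : IsCDC r d C) (hr : r ≤ n) :
    C.ncard ≤ Nat.card F ^ ((n - r + 1) * (r - (d - 1))) := by
  set t := r - (d - 1) with ht
  have : Fintype C := Fintype.ofFinite C
  let φ : (Σ U : C, {s : Fin t → U.1 // LinearIndependent F s}) → (Fin t → Fin n → F) :=
    fun x i => (x.2.1 i : Fin n → F)
  have hφ : Function.Injective φ := by
    rintro ⟨U, s, hs⟩ ⟨V, s', hs'⟩ hss
    have hval : ∀ i, (s i : Fin n → F) = s' i := fun i => congrFun hss i
    have hUV : U = V := by
      by_contra hne
      have hd := h.2.2 U.2 V.2 (fun e => hne (Subtype.ext e))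
      have hle : t ≤ Module.finrank F ↥(U.1 ⊓ V.1) := by
        let s2 : Fin t → ↥(U.1 ⊓ V.1) := fun i => ⟨s i, (s i).2, by rw [hval]; exact (s' i).2⟩
        have hs2 : LinearIndependent F s2 := by
          apply LinearIndependent.of_comp (U.1 ⊓ V.1).subtype
          exact hs.map' U.1.subtype (Submodule.ker_subtype _)
        simpa using hs2.fintype_card_le_finrank
      have hU := h.2.1 _ U.2
      have hV := h.2.1 _ V.2
      simp only [injectionDist, hU, hV, max_self] at hd
      -- For d ≥ 1, `hd` and `hle` already clash. Only d = 0 survives; there t = r, and the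
      -- contradiction comes from U ≠ V.
      have hinf : Module.finrank F ↥(U.1 ⊓ V.1) = r := by
        have := Submodule.finrank_mono (inf_le_left : U.1 ⊓ V.1 ≤ U.1)
        omega
      have e1 := Submodule.eq_of_le_of_finrank_eq (inf_le_left : U.1 ⊓ V.1 ≤ U.1) (by omega)
      have e2 := Submodule.eq_of_le_of_finrank_eq (inf_le_right : U.1 ⊓ V.1 ≤ V.1) (by omega)
      exact hne (Subtype.ext (e1.symm.trans e2))
    subst hUV
    have : s = s' := funext fun i => Subtype.ext (hval i)
    subst this
    rfl
  have hcard := Nat.card_le_card_of_injective φ hφ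
  rw [Nat.card_sigma, Nat.card_fun, Nat.card_fun, Nat.card_fin, Nat.card_fin, ← pow_mul] at hcard
  have hsum : C.ncard * Nat.card F ^ ((r - 1) * t) ≤ Nat.card F ^ (n * t) := by
    refine le_trans ?_ hcard
    rw [← Nat.card_coe_set_eq, Nat.card_eq_fintype_card, ← smul_eq_mul]
    exact Finset.card_nsmul_le_sum _ _ _ fun U _ =>
      pow_le_card_linearIndependent (h.2.1 _ U.2) (by omega)
  have hexp : n * t = (n - r + 1) * t + (r - 1) * t := by
    rcases Nat.eq_zero_or_pos r with h0 | h0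
    · have : t = 0 := by omega
      simp [this]
    · rw [← add_mul]; congr 1; omega
  rw [hexp, pow_add] at hsum
  exact Nat.le_of_mul_le_mul_right hsum (pow_pos Nat.card_pos _)

theorem maxCDC_le_pow [Finite F] {n r d : ℕ} (hr : r ≤ n) :
    maxCDC F n r d ≤ Nat.card F ^ ((n - r + 1) * (r - (d - 1))) :=
  maxCDC_le fun _ hC => hC.ncard_le hr

/-- The orthogonal complement of a subspace of `F ^ n`. -/
noncomputable def orthogonal {n : ℕ} (U : Submodule F (Fin n → F)) : Submodule F (Fin n → F) :=
  U.dualAnnihilator.map (Pi.basisFun F (Fin n)).toDualEquiv.symm.toLinearMap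

theorem orthogonal_injective {n : ℕ} :
    Function.Injective (orthogonal : Submodule F (Fin n → F) → _) := fun _ _ h =>
  Subspace.dualAnnihilator_inj.1
    (Submodule.map_injective_of_injective (LinearEquiv.injective _) h)

theorem finrank_orthogonal {n : ℕ} (U : Submodule F (Fin n → F)) :
    Module.finrank F U + Module.finrank F (orthogonal U) = n := by
  rw [orthogonal, LinearEquiv.finrank_map_eq, Subspace.finrank_add_finrank_dualAnnihilator_eq,
    Module.finrank_fin_fun]

theorem orthogonal_inf {n : ℕ} (U V : Submodule F (Fin n → F)) :
    orthogonal U ⊓ orthogonal V = orthogonal (U ⊔ V) := by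
  rw [orthogonal, orthogonal, orthogonal, Submodule.dualAnnihilator_sup_eq,
    Submodule.map_inf _ (LinearEquiv.injective _)]

/-- The complements meet in the complement of U + V, and dim(U + V) - r = r - dim(U ∩ V), so
injection distance is preserved. -/
theorem IsCDC.image_orthogonal {n r d : ℕ} {C : Set (Submodule F (Fin n → F))}
    (h : IsCDC r d C) : IsCDC (n - r) d (orthogonal '' C) := by
  refine ⟨h.1.image _, ?_, ?_⟩
  · rintro _ ⟨U, hU, rfl⟩
    have := finrank_orthogonal U
    have := h.2.1 U hU
    omega
  · rintro _ ⟨U, hU, rfl⟩ _ ⟨V, hV, rfl⟩ hne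
    have hd := h.2.2 hU hV (fun e => hne (e ▸ rfl))
    unfold injectionDist at hd ⊢
    rw [orthogonal_inf]
    have := finrank_orthogonal U
    have := finrank_orthogonal V
    have := finrank_orthogonal (U ⊔ V)
    have := h.2.1 U hU
    have := h.2.1 V hV
    have := Submodule.finrank_sup_add_finrank_inf_eq U V
    omega

theorem maxCDC_le_maxCDC_sub [Finite F] {n r d : ℕ} : maxCDC F n r d ≤ maxCDC F n (n - r) d :=
  maxCDC_le fun C hC => by
    rw [← Set.ncard_image_of_injective C orthogonal_injective]
    exact hC.image_orthogonal.ncard_le_maxCDC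

theorem maxCDC_sub [Finite F] {n r d : ℕ} (hr : r ≤ n) :
    maxCDC F n (n - r) d = maxCDC F n r d := by
  refine le_antisymm ?_ maxCDC_le_maxCDC_sub
  have := maxCDC_le_maxCDC_sub (F := F) (n := n) (r := n - r) (d := d)
  rwa [Nat.sub_sub_self hr] at this

theorem exists_linearIndependent_fin {V : Type*} [AddCommGroup V] [Module F V]
    [FiniteDimensional F V] {r : ℕ} (hr : r ≤ Module.finrank F V) :
    ∃ s : Fin r → V, LinearIndependent F s :=
  ⟨_, (Module.finBasis F V).linearIndependent.comp (Fin.castLE hr) (Fin.castLE_injective hr)⟩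

theorem one_le_maxCDC [Finite F] {n r d : ℕ} (hr : r ≤ n) : 1 ≤ maxCDC F n r d := by
  obtain ⟨s, hs⟩ := exists_linearIndependent_fin (F := F) (V := Fin n → F) (by simpa using hr)
  have h : IsCDC r d {Submodule.span F (Set.range s)} :=
    ⟨Set.singleton_nonempty _, by simpa using finrank_span_eq_card hs, by simp⟩
  simpa using h.ncard_le_maxCDC

theorem subspaceDist_eq {n : ℕ} (U V : Submodule F (Fin n → F))
    (h : Module.finrank F U = Module.finrank F V) :
    subspaceDist U V = 2 * injectionDist U V := by
  unfold subspaceDist injectionDist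
  have := Submodule.finrank_sup_add_finrank_inf_eq U V
  have := Submodule.finrank_mono (inf_le_left : U ⊓ V ≤ U)
  omega

theorem maxCDC_le_maxCode [Finite F] {n r d e : ℕ} (h : d ≤ 2 * e) :
    maxCDC F n r e ≤ maxCode F n d := by
  refine maxCDC_le fun C hC => IsCode.ncard_le_maxCode ⟨hC.1, fun U hU V hV hne => ?_⟩
  have hd : e ≤ injectionDist U V := hC.2.2 hU hV hne
  change d ≤ subspaceDist U V
  rw [subspaceDist_eq U V ((hC.2.1 U hU).trans (hC.2.1 V hV).symm)]
  omega

/-- Slice by dimension. Within a layer subspace distances are even, so an odd d rounds up; hence d +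
1 in the hypothesis. -/
theorem maxCode_le_mul [Finite F] {n d e B : ℕ} (h : 2 * e ≤ d + 1)
    (hB : ∀ r ≤ n, maxCDC F n r e ≤ B) : maxCode F n d ≤ (n + 1) * B := by
  refine maxCode_le fun C hC => ?_
  have hdim : ∀ U : Submodule F (Fin n → F), Module.finrank F U ≤ n := fun U => by
    simpa using U.finrank_le
  have hC' : C = ⋃ r ∈ Finset.range (n + 1), {U ∈ C | Module.finrank F U = r} := by
    ext U
    simp only [Finset.mem_range, Set.mem_iUnion, Set.mem_ofPred_eq, exists_prop]
    exact ⟨fun hU => ⟨_, Nat.lt_succ_of_le (hdim U), hU, rfl⟩, fun ⟨_, _, hU, _⟩ => hU⟩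
  rw [hC']
  refine (Finset.set_ncard_biUnion_le _ _).trans ?_
  refine (Finset.sum_le_card_nsmul _ _ B fun r hr => ?_).trans (by simp)
  rcases Set.eq_empty_or_nonempty {U ∈ C | Module.finrank F U = r} with h0 | h0
  · rw [h0]; simp
  · refine (IsCDC.ncard_le_maxCDC (d := e) ⟨h0, fun U hU => hU.2, ?_⟩).trans
      (hB r (Nat.lt_succ_iff.1 (Finset.mem_range.1 hr)))
    intro U hU V hV hne
    have : d ≤ subspaceDist U V := hC.2 hU.1 hV.1 hne
    rw [subspaceDist_eq U V (hU.2.trans hV.2.symm)] at this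
    omega

theorem maxCode_zero [Finite F] (n : ℕ) : maxCode F n 0 = numSubspaces F n := by
  refine le_antisymm (maxCode_le fun C _ => Set.ncard_le_card C) ?_
  have h : IsCode 0 (Set.univ : Set (Submodule F (Fin n → F))) :=
    ⟨Set.univ_nonempty, fun _ _ _ _ _ => Nat.zero_le _⟩
  simpa [Set.ncard_univ, numSubspaces] using h.ncard_le_maxCode

end Combinatorics

/-! ### Linearised polynomials and lifted Gabidulin codes -/

section Gabidulin

variable {F : Type*} [Field F]

/-- The linear map `x ↦ ∑ i, a i * x ^ q ^ i` of a `q`-polynomial of `q`-degree less than `k`. -/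
noncomputable def qPolynomialMap [Finite F] (L : Type*) [Field L] [Algebra F L] {k : ℕ} (a : Fin k → L) :
    L →ₗ[F] L :=
  haveI := Fintype.ofFinite F
  ∑ i, LinearMap.mulLeft F (a i) ∘ₗ (FiniteField.frobeniusAlgHom F L ^ (i : ℕ)).toLinearMap

theorem qPolynomialMap_apply [Finite F] {L : Type*} [Field L] [Algebra F L] {k : ℕ} (a : Fin k → L) (x : L) :
    qPolynomialMap (F := F) L a x = ∑ i, a i * x ^ Nat.card F ^ (i : ℕ) := by
  simp [qPolynomialMap, -Nat.card_eq_fintype_card, Fintype.card_eq_nat_card,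
    LinearMap.sum_apply, AlgHom.coe_pow,
    FiniteField.coe_frobeniusAlgHom, pow_iterate]

theorem qPolynomialMap_sub [Finite F] {L : Type*} [Field L] [Algebra F L] {k : ℕ} (a b : Fin k → L) :
    qPolynomialMap (F := F) L (a - b) = qPolynomialMap L a - qPolynomialMap L b := by
  ext x
  simp [qPolynomialMap_apply, sub_mul]

/-- The kernel consists of roots of a nonzero polynomial of degree at most q^(k-1), so it has at
most q^(k-1) elements. -/
theorem finrank_ker_qPolynomialMap_lt [Finite F] {L : Type*} [Field L] [Algebra F L] [Finite L] {k : ℕ}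
    {a : Fin k → L} (ha : a ≠ 0) :
    Module.finrank F (LinearMap.ker (qPolynomialMap (F := F) L a)) < k := by
  classical
  have hq : 1 < Nat.card F := Finite.one_lt_card
  obtain ⟨j, hj⟩ : ∃ j, a j ≠ 0 := by
    by_contra! h
    exact ha (funext h)
  let p : Polynomial L := ∑ i : Fin k, Polynomial.monomial (Nat.card F ^ (i : ℕ)) (a i)
  have hp : p ≠ 0 := by
    intro h
    apply hj
    have := congrArg (fun P => Polynomial.coeff P (Nat.card F ^ (j : ℕ))) h
    simp only [p, Polynomial.finsetSum_coeff, Polynomial.coeff_monomial,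
      Polynomial.coeff_zero] at this
    rw [Finset.sum_eq_single j] at this
    · simpa using this
    · intro i _ hi
      rw [if_neg]
      exact fun e => hi (Fin.ext (Nat.pow_right_injective hq e))
    · simp
  have hdeg : p.natDegree ≤ Nat.card F ^ (k - 1) := by
    refine Polynomial.natDegree_sum_le_of_forall_le _ _ fun i _ => ?_
    refine (Polynomial.natDegree_monomial_le _).trans (Nat.pow_le_pow_right (by omega) ?_)
    omega
  have hroot : ∀ x ∈ LinearMap.ker (qPolynomialMap (F := F) L a), x ∈ p.roots.toFinset := by
    intro x hx
    rw [LinearMap.mem_ker, qPolynomialMap_apply] at hx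
    rw [Multiset.mem_toFinset, Polynomial.mem_roots hp, Polynomial.IsRoot]
    simpa [p, Polynomial.eval_finsetSum] using hx
  have hcard : Nat.card (LinearMap.ker (qPolynomialMap (F := F) L a)) ≤ Nat.card F ^ (k - 1) := by
    calc _ ≤ p.roots.toFinset.card := by
          rw [← Set.ncard_coe_finset, ← SetLike.coe_sort_coe, Nat.card_coe_set_eq]
          exact Set.ncard_le_ncard hroot
      _ ≤ p.natDegree := (Multiset.toFinset_card_le _).trans p.card_roots'
      _ ≤ _ := hdeg
  rw [Module.natCard_eq_pow_finrank (K := F), Nat.pow_le_pow_iff_right hq] at hcard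
  have := j.2
  omega

/-- The graph of a linear map, transported to `F ^ n`. -/
noncomputable def liftedGraph {V W : Type*} [AddCommGroup V] [Module F V] [AddCommGroup W]
    [Module F W] {n : ℕ} (e : (V × W) ≃ₗ[F] (Fin n → F)) (f : V →ₗ[F] W) :
    Submodule F (Fin n → F) :=
  f.graph.map e.toLinearMap

theorem finrank_liftedGraph {V W : Type*} [AddCommGroup V] [Module F V] [AddCommGroup W]
    [Module F W] {n : ℕ} (e : (V × W) ≃ₗ[F] (Fin n → F)) (f : V →ₗ[F] W) :
    Module.finrank F (liftedGraph e f) = Module.finrank F V := by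
  rw [liftedGraph, LinearEquiv.finrank_map_eq, LinearMap.graph_eq_range_prod]
  exact LinearMap.finrank_range_of_inj fun x y h => congrArg Prod.fst h

theorem finrank_liftedGraph_inf_le {V W : Type*} [AddCommGroup V] [Module F V]
    [FiniteDimensional F V] [AddCommGroup W]
    [Module F W] {n : ℕ} (e : (V × W) ≃ₗ[F] (Fin n → F)) (f g : V →ₗ[F] W) :
    Module.finrank F ↥(liftedGraph e f ⊓ liftedGraph e g) ≤
      Module.finrank F (LinearMap.ker (f - g)) := by
  rw [liftedGraph, liftedGraph, ← Submodule.map_inf _ e.injective, LinearEquiv.finrank_map_eq]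
  have : f.graph ⊓ g.graph ≤ (LinearMap.ker (f - g)).map (LinearMap.prod LinearMap.id f) := by
    rintro ⟨x, y⟩ ⟨hf, hg⟩
    simp only [SetLike.mem_coe, LinearMap.mem_graph_iff] at hf hg
    exact ⟨x, by simp [← hf, ← hg], by simp [hf]⟩
  exact (Submodule.finrank_mono this).trans (Submodule.finrank_map_le _ _)

/-- Lifted Gabidulin codes. -/
theorem pow_le_maxCDC [Finite F] {n r d : ℕ} (hr : r ≤ n - r) (hd : d ≤ r) :
    Nat.card F ^ ((n - r) * (r - d)) ≤ maxCDC F n r d := by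
  rcases Nat.eq_zero_or_pos (n - r) with h0 | h0
  · rw [h0]; simpa using one_le_maxCDC (by omega)
  obtain ⟨p, hp⟩ := CharP.exists F
  have : Fact p.Prime := ⟨CharP.char_is_prime F p⟩
  have : NeZero (n - r) := ⟨h0.ne'⟩
  let L := FiniteField.Extension F p (n - r)
  have hL : Module.finrank F L = n - r := FiniteField.finrank_extension F p (n - r)
  obtain ⟨ι, hι⟩ : ∃ ι : (Fin r → F) →ₗ[F] L, Function.Injective ι := by
    obtain ⟨s, hs⟩ := exists_linearIndependent_fin (F := F) (V := L) (r := r) (by omega)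
    exact ⟨Fintype.linearCombination F s, linearIndependent_iff_injective_fintypeLinearCombination.1 hs⟩
  let e : ((Fin r → F) × L) ≃ₗ[F] (Fin n → F) :=
    LinearEquiv.ofFinrankEq _ _ (by rw [Module.finrank_prod, hL]; simp; omega)
  -- Using r - d coefficients instead of r - d + 1 costs only n - r in the exponent, and lets d = 0
  -- be treated uniformly.
  let c : (Fin (r - d) → L) → Submodule F (Fin n → F) :=
    fun a => liftedGraph e (qPolynomialMap L a ∘ₗ ι)
  have hinf : ∀ a b, a ≠ b → Module.finrank F ↥(c a ⊓ c b) < r - d := by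
    intro a b hab
    refine (finrank_liftedGraph_inf_le e _ _).trans_lt ?_
    rw [← LinearMap.sub_comp, ← qPolynomialMap_sub]
    refine lt_of_le_of_lt ?_ (finrank_ker_qPolynomialMap_lt (F := F) (sub_ne_zero.2 hab))
    rw [LinearMap.ker_comp, (Submodule.equivMapOfInjective ι hι _).finrank_eq]
    exact Submodule.finrank_mono (Submodule.map_comap_le _ _)
  have hdim : ∀ a, Module.finrank F (c a) = r := fun a => by
    rw [finrank_liftedGraph]; simp
  have hinj : Function.Injective c := by
    intro a b hab
    by_contra hne
    have := hinf a b hne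
    rw [hab, inf_idem, hdim] at this
    omega
  have hcode : IsCDC r d (Set.range c) := by
    refine ⟨Set.range_nonempty c, ?_, ?_⟩
    · rintro _ ⟨a, rfl⟩
      exact hdim a
    · rintro _ ⟨a, rfl⟩ _ ⟨b, rfl⟩ hne
      have := hinf a b (fun e => hne (e ▸ rfl))
      unfold injectionDist
      rw [hdim, hdim, max_self]
      omega
  have hcard := hcode.ncard_le_maxCDC
  rw [← Set.image_univ, Set.ncard_image_of_injective _ hinj, Set.ncard_univ, Nat.card_fun,
    Nat.card_fin, Module.natCard_eq_pow_finrank (K := F), hL, ← pow_mul] at hcard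
  exact hcard

end Gabidulin

/-! ### Explicit bounds for the logarithms -/

section Logarithms

variable {F : Type*} [Field F] [Finite F]

theorem one_lt_card_real : (1 : ℝ) < Nat.card F := by
  exact_mod_cast (Finite.one_lt_card : 1 < Nat.card F)

theorem logb_le_of_le_pow {M k : ℕ} (hM : 1 ≤ M) (h : M ≤ Nat.card F ^ k) :
    Real.logb (Nat.card F) M ≤ k := by
  have hq := one_lt_card_real (F := F)
  rw [Real.logb_le_iff_le_rpow hq (by exact_mod_cast hM), Real.rpow_natCast]
  exact_mod_cast h

theorem le_logb_of_pow_le {M k : ℕ} (h : Nat.card F ^ k ≤ M) :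
    (k : ℝ) ≤ Real.logb (Nat.card F) M := by
  have hq := one_lt_card_real (F := F)
  have hM : 0 < M := (pow_pos Nat.card_pos _).trans_le h
  rw [Real.le_logb_iff_rpow_le hq (by exact_mod_cast hM), Real.rpow_natCast]
  exact_mod_cast h

theorem logb_maxCDC_le_of_le {n r d : ℕ} (hr : r ≤ n) :
    Real.logb (Nat.card F) (maxCDC F n r d) ≤ ((n : ℝ) - r + 1) * max 0 ((r : ℝ) - d + 1) := by
  refine (logb_le_of_le_pow (one_le_maxCDC hr) (maxCDC_le_pow hr)).trans ?_
  rw [Nat.cast_mul, Nat.cast_add, Nat.cast_sub hr, Nat.cast_one]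
  have : (r : ℝ) ≤ n := by exact_mod_cast hr
  refine mul_le_mul_of_nonneg_left ?_ (by linarith)
  rcases le_total (d - 1) r with h | h
  · refine le_max_of_le_right ?_
    rw [Nat.cast_sub h]
    have : (d : ℝ) ≤ (d - 1 : ℕ) + 1 := by exact_mod_cast (by omega : d ≤ d - 1 + 1)
    linarith
  · rw [Nat.sub_eq_zero_of_le h]
    simp

theorem logb_maxCDC_nonneg {n r d : ℕ} (hr : r ≤ n) :
    0 ≤ Real.logb (Nat.card F) (maxCDC F n r d) :=
  Real.logb_nonneg one_lt_card_real (by exact_mod_cast one_le_maxCDC hr)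

theorem le_logb_maxCDC_of_le {n r d : ℕ} (hr : r ≤ n - r) :
    ((n : ℝ) - r) * max 0 ((r : ℝ) - d) ≤ Real.logb (Nat.card F) (maxCDC F n r d) := by
  have hrn : r ≤ n := by omega
  rcases le_total d r with h | h
  · have := le_logb_of_pow_le (pow_le_maxCDC (F := F) hr h)
    rw [Nat.cast_mul, Nat.cast_sub hrn, Nat.cast_sub h] at this
    rwa [max_eq_right (sub_nonneg.2 (by exact_mod_cast h))]
  · rw [max_eq_left (sub_nonpos.2 (by exact_mod_cast h)), mul_zero]
    exact logb_maxCDC_nonneg hrn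

theorem logb_maxCDC_le {n r d : ℕ} (hr : r ≤ n) :
    Real.logb (Nat.card F) (maxCDC F n r d) ≤
      (max (r : ℝ) (n - r) + 1) * max 0 (min (r : ℝ) (n - r) - d + 1) := by
  rcases le_total (r : ℝ) (n - r) with h | h
  · rw [max_eq_right h, min_eq_left h]
    exact logb_maxCDC_le_of_le hr
  · rw [max_eq_left h, min_eq_right h, ← maxCDC_sub hr]
    simpa [Nat.cast_sub hr] using logb_maxCDC_le_of_le (F := F) (d := d) (Nat.sub_le n r)

theorem le_logb_maxCDC {n r d : ℕ} (hr : r ≤ n) :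
    max (r : ℝ) (n - r) * max 0 (min (r : ℝ) (n - r) - d) ≤
      Real.logb (Nat.card F) (maxCDC F n r d) := by
  have hcast : ((n - r : ℕ) : ℝ) = n - r := Nat.cast_sub hr
  rcases le_total r (n - r) with h | h
  · have h' : (r : ℝ) ≤ n - r := by rw [← hcast]; exact_mod_cast h
    rw [max_eq_right h', min_eq_left h']
    exact le_logb_maxCDC_of_le h
  · have h' : (n : ℝ) - r ≤ r := by rw [← hcast]; exact_mod_cast h
    rw [max_eq_left h', min_eq_right h', ← maxCDC_sub hr]
    simpa [hcast] using le_logb_maxCDC_of_le (F := F) (n := n) (r := n - r) (d := d) (by omega)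

theorem logb_maxCode_le {n d e : ℕ} (h : 2 * e ≤ d + 1) :
    Real.logb (Nat.card F) (maxCode F n d) ≤
      n + ((n : ℝ) / 2 + 1) * max 0 ((n : ℝ) / 2 - e + 1) := by
  have hq := one_lt_card_real (F := F)
  obtain ⟨r, hr, hmax⟩ := Finset.exists_max_image (Finset.range (n + 1))
    (fun r => maxCDC F n r e) ⟨0, by simp⟩
  have hrn : r ≤ n := Nat.lt_succ_iff.1 (Finset.mem_range.1 hr)
  have hle : maxCode F n d ≤ (n + 1) * maxCDC F n r e :=
    maxCode_le_mul h fun s hs => hmax s (Finset.mem_range.2 (Nat.lt_succ_of_le hs))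
  have h1 : 1 ≤ maxCDC F n r e := one_le_maxCDC hrn
  have h2 : 1 ≤ maxCode F n d := by
    have h0 : IsCode d {(⊥ : Submodule F (Fin n → F))} := ⟨Set.singleton_nonempty _, by simp⟩
    simpa using h0.ncard_le_maxCode
  have hn : n + 1 ≤ Nat.card F ^ n :=
    Nat.lt_pow_self (Finite.one_lt_card : 1 < Nat.card F)
  calc Real.logb (Nat.card F) (maxCode F n d)
      ≤ Real.logb (Nat.card F) (((n + 1 : ℕ) : ℝ) * maxCDC F n r e) :=
        Real.logb_le_logb_of_le hq (by exact_mod_cast h2) (by exact_mod_cast hle)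
    _ = Real.logb (Nat.card F) (n + 1 : ℕ) + Real.logb (Nat.card F) (maxCDC F n r e) :=
        Real.logb_mul (by positivity) (by positivity)
    _ ≤ n + (max (r : ℝ) (n - r) + 1) * max 0 (min (r : ℝ) (n - r) - e + 1) :=
        add_le_add (logb_le_of_le_pow (by omega) hn) (logb_maxCDC_le hrn)
    _ ≤ _ := by
      refine add_le_add le_rfl ?_
      -- Here c = |r - n/2|. Moving from the middle layer to r lowers the product by c(e + c) ≥ 0.
      obtain ⟨c, hc, hmx, hmn⟩ : ∃ c : ℝ, 0 ≤ c ∧ max (r : ℝ) (n - r) = n / 2 + c ∧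
          min (r : ℝ) (n - r) = n / 2 - c := by
        rcases le_total (r : ℝ) (n - r) with h | h
        · exact ⟨n / 2 - r, by linarith, by rw [max_eq_right h]; ring,
            by rw [min_eq_left h]; ring⟩
        · exact ⟨r - n / 2, by linarith, by rw [max_eq_left h]; ring,
            by rw [min_eq_right h]; ring⟩
      rw [hmx, hmn]
      have hn0 : (0 : ℝ) ≤ n := n.cast_nonneg
      have he0 : (0 : ℝ) ≤ e := e.cast_nonneg
      rcases le_total ((n : ℝ) / 2 - c - e + 1) 0 with hneg | hpos
      · rw [max_eq_left hneg, mul_zero]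
        positivity
      · rw [max_eq_right hpos, max_eq_right (by linarith)]
        nlinarith [mul_nonneg hc he0, mul_nonneg hc hc]

end Logarithms

/-! ### Limits at scale n^2 -/

section Limits

theorem max_zero_mul {a : ℝ} (ha : 0 ≤ a) (b : ℝ) : max 0 (a * b) = a * max 0 b := by
  rw [mul_max_of_nonneg _ _ ha, mul_zero]

variable {F : Type*} [Field F] [Finite F]

theorem tendsto_logb_maxCDC {l : Filter ℕ} (hl : l ≤ atTop) {r d : ℕ → ℕ} {ρ δ : ℝ}
    (hrn : ∀ᶠ n in l, r n ≤ n) (hr : Tendsto (fun n => (r n : ℝ) / n) l (𝓝 ρ))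
    (hd : Tendsto (fun n => (d n : ℝ) / n) l (𝓝 δ)) :
    Tendsto (fun n : ℕ => Real.logb (Nat.card F) (maxCDC F n (r n) (d n)) / (n : ℝ) ^ 2) l
      (𝓝 (max ρ (1 - ρ) * max 0 (min ρ (1 - ρ) - δ))) := by
  have hinv : Tendsto (fun n : ℕ => 1 / (n : ℝ)) l (𝓝 0) :=
    tendsto_one_div_atTop_nhds_zero_nat.mono_left hl
  have hpos : ∀ᶠ n : ℕ in l, 0 < n := hl (eventually_gt_atTop 0)
  have hr' : Tendsto (fun n => 1 - (r n : ℝ) / n) l (𝓝 (1 - ρ)) := tendsto_const_nhds.sub hr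
  have hlow : Tendsto (fun n => max ((r n : ℝ) / n) (1 - (r n : ℝ) / n) *
      max 0 (min ((r n : ℝ) / n) (1 - (r n : ℝ) / n) - (d n : ℝ) / n)) l
      (𝓝 (max ρ (1 - ρ) * max 0 (min ρ (1 - ρ) - δ))) :=
    (hr.max hr').mul (tendsto_const_nhds.max ((hr.min hr').sub hd))
  have hupp : Tendsto (fun n => (max ((r n : ℝ) / n) (1 - (r n : ℝ) / n) + 1 / (n : ℝ)) *
      max 0 (min ((r n : ℝ) / n) (1 - (r n : ℝ) / n) - (d n : ℝ) / n + 1 / (n : ℝ))) l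
      (𝓝 ((max ρ (1 - ρ) + 0) * max 0 (min ρ (1 - ρ) - δ + 0))) :=
    ((hr.max hr').add hinv).mul (tendsto_const_nhds.max (((hr.min hr').sub hd).add hinv))
  rw [add_zero, add_zero] at hupp
  have key : ∀ n : ℕ, 0 < n → (n : ℝ) * max ((r n : ℝ) / n) (1 - (r n : ℝ) / n) =
      max (r n : ℝ) (n - r n) ∧ (n : ℝ) * min ((r n : ℝ) / n) (1 - (r n : ℝ) / n) =
      min (r n : ℝ) (n - r n) := by
    intro n hn
    have hn' : (0 : ℝ) < n := by exact_mod_cast hn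
    rw [mul_max_of_nonneg _ _ hn'.le, mul_min_of_nonneg _ _ hn'.le, mul_sub, mul_one,
      mul_div_cancel₀ _ hn'.ne']
    exact ⟨rfl, rfl⟩
  refine tendsto_of_tendsto_of_tendsto_of_le_of_le' hlow hupp ?_ ?_
  · filter_upwards [hrn, hpos] with n h1 h2
    have hn' : (0 : ℝ) < n := by exact_mod_cast h2
    obtain ⟨k1, k2⟩ := key n h2
    rw [le_div_iff₀ (by positivity)]
    refine le_trans (le_of_eq ?_) (le_logb_maxCDC h1)
    rw [← k1, ← k2]
    have : (n : ℝ) * min ((r n : ℝ) / n) (1 - (r n : ℝ) / n) - d n =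
        n * (min ((r n : ℝ) / n) (1 - (r n : ℝ) / n) - (d n : ℝ) / n) := by
      field_simp
    rw [this, max_zero_mul hn'.le]
    ring
  · filter_upwards [hrn, hpos] with n h1 h2
    have hn' : (0 : ℝ) < n := by exact_mod_cast h2
    obtain ⟨k1, k2⟩ := key n h2
    rw [div_le_iff₀ (by positivity)]
    refine (logb_maxCDC_le h1).trans (le_of_eq ?_)
    rw [← k1, ← k2]
    have : (n : ℝ) * min ((r n : ℝ) / n) (1 - (r n : ℝ) / n) - d n + 1 =
        n * (min ((r n : ℝ) / n) (1 - (r n : ℝ) / n) - (d n : ℝ) / n + 1 / n) := by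
      field_simp
    rw [this, max_zero_mul hn'.le]
    field_simp

theorem tendsto_nat_half_div : Tendsto (fun n : ℕ => ((n / 2 : ℕ) : ℝ) / n) atTop (𝓝 (1 / 2)) := by
  have h := (tendsto_nat_floor_mul_div_atTop (R := ℝ) (a := 1 / 2) (by norm_num)).comp
    tendsto_natCast_atTop_atTop
  refine h.congr fun n => ?_
  have : ⌊(1 / 2 : ℝ) * n⌋₊ = n / 2 := by
    rw [← Nat.floor_div_eq_div (K := ℝ)]
    congr 1
    push_cast
    ring
  simp only [Function.comp_apply, this]

theorem tendsto_logb_maxCode {d : ℕ → ℕ} {δ : ℝ}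
    (hd : Tendsto (fun n => (d n : ℝ) / n) atTop (𝓝 δ)) :
    Tendsto (fun n : ℕ => Real.logb (Nat.card F) (maxCode F n (d n)) / (n : ℝ) ^ 2) atTop
      (𝓝 (1 / 2 * max 0 (1 / 2 - δ / 2))) := by
  have hinv : Tendsto (fun n : ℕ => 1 / (n : ℝ)) atTop (𝓝 0) :=
    tendsto_one_div_atTop_nhds_zero_nat
  -- The natural quotient (d + 1)/2 is ⌈d/2⌉, which meets both d ≤ 2e (lower bound) and 2e ≤ d + 1
  -- (upper bound).
  have he : Tendsto (fun n => (((d n + 1) / 2 : ℕ) : ℝ) / n) atTop (𝓝 (δ / 2)) := by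
    have h2 : Tendsto (fun n : ℕ => (d n : ℝ) / n / 2 + 1 / n) atTop (𝓝 (δ / 2 + 0)) :=
      (hd.div_const 2).add hinv
    rw [add_zero] at h2
    refine tendsto_of_tendsto_of_tendsto_of_le_of_le (hd.div_const 2) h2 (fun n => ?_) fun n => ?_
    · have : (d n : ℝ) ≤ 2 * ((d n + 1) / 2 : ℕ) := by
        exact_mod_cast (by omega : d n ≤ 2 * ((d n + 1) / 2))
      change (d n : ℝ) / n / 2 ≤ _
      rw [div_right_comm]
      gcongr
      linarith
    · have : 2 * (((d n + 1) / 2 : ℕ) : ℝ) ≤ d n + 2 := by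
        exact_mod_cast (by omega : 2 * ((d n + 1) / 2) ≤ d n + 2)
      change _ ≤ (d n : ℝ) / n / 2 + 1 / n
      rw [div_right_comm, ← add_div]
      gcongr
      linarith
  have hlow := tendsto_logb_maxCDC (F := F) le_rfl (Eventually.of_forall fun n => Nat.div_le_self n 2)
    tendsto_nat_half_div he
  norm_num only [max_self, min_self] at hlow
  have hupp : Tendsto (fun n : ℕ => 1 / (n : ℝ) + (1 / 2 + 1 / (n : ℝ)) *
      max 0 (1 / 2 - (((d n + 1) / 2 : ℕ) : ℝ) / n + 1 / (n : ℝ))) atTop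
      (𝓝 (0 + (1 / 2 + 0) * max 0 (1 / 2 - δ / 2 + 0))) :=
    hinv.add ((tendsto_const_nhds.add hinv).mul
      (tendsto_const_nhds.max ((tendsto_const_nhds.sub he).add hinv)))
  rw [add_zero, add_zero, zero_add] at hupp
  refine tendsto_of_tendsto_of_tendsto_of_le_of_le' hlow hupp ?_ ?_
  · refine Eventually.of_forall fun n => ?_
    refine div_le_div_of_nonneg_right ?_ (by positivity)
    refine Real.logb_le_logb_of_le one_lt_card_real ?_ ?_
    · exact_mod_cast one_le_maxCDC (Nat.div_le_self n 2)
    · exact_mod_cast maxCDC_le_maxCode (by omega)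
  · filter_upwards [eventually_gt_atTop 0] with n h2
    have hn' : (0 : ℝ) < n := by exact_mod_cast h2
    rw [div_le_iff₀ (by positivity)]
    refine (logb_maxCode_le (e := (d n + 1) / 2) (by omega)).trans (le_of_eq ?_)
    have : (n : ℝ) / 2 - ((d n + 1) / 2 : ℕ) + 1 =
        n * (1 / 2 - (((d n + 1) / 2 : ℕ) : ℝ) / n + 1 / (n : ℝ)) := by
      field_simp
    rw [this, max_zero_mul hn'.le]
    field_simp

theorem tendsto_rate {l : Filter ℕ} (hl : l ≤ atTop) {M : ℕ → ℕ} {c : ℝ}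
    (hM : Tendsto (fun n => Real.logb (Nat.card F) (M n) / (n : ℝ) ^ 2) l (𝓝 c)) :
    Tendsto (fun n => (rate F n (M n) : EReal)) l (𝓝 ((4 * c : ℝ) : EReal)) := by
  have hE : Tendsto (fun n : ℕ => Real.logb (Nat.card F) (numSubspaces F n) / (n : ℝ) ^ 2) atTop
      (𝓝 (1 / 4)) := by
    have h := tendsto_logb_maxCode (F := F) (d := fun _ => 0) (δ := 0) (by simp)
    simp only [maxCode_zero] at h
    convert h using 2
    norm_num
  refine (continuous_coe_real_ereal.tendsto _).comp ?_
  have h := hM.div (hE.mono_left hl) (by norm_num)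
  have hc : c / (1 / 4) = 4 * c := by ring
  rw [hc] at h
  refine h.congr' ?_
  filter_upwards [hl (eventually_gt_atTop 0)] with n hn
  have hn' : ((n : ℝ) ^ 2) ≠ 0 := by positivity
  exact div_div_div_cancel_right₀ hn' _ _

theorem tendsto_ceil_mul_div {a : ℝ} (ha : 0 ≤ a) :
    Tendsto (fun n : ℕ => (⌈(n : ℝ) * a⌉₊ : ℝ) / n) atTop (𝓝 a) := by
  have h := (tendsto_nat_ceil_mul_div_atTop (R := ℝ) ha).comp tendsto_natCast_atTop_atTop
  simpa only [Function.comp_def, mul_comm a] using h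

theorem asympRate_eq {d' : ℝ} (hd0 : 0 ≤ d') (hd1 : d' ≤ 1) :
    asympRate F d' = ((1 - d' : ℝ) : EReal) := by
  have h := (tendsto_rate le_rfl
    (tendsto_logb_maxCode (F := F) (tendsto_ceil_mul_div hd0))).limsup_eq
  rw [max_eq_right (by linarith)] at h
  refine h.trans (congrArg _ ?_)
  ring

theorem asympRateCDC_eq {d' ρ : ℝ} (hd0 : 0 ≤ d') {N : Set ℕ} {r : ℕ → ℕ} (hN : N.Infinite)
    (hrn : ∀ n ∈ N, r n ≤ n) (hr : Tendsto (fun n => (r n : ℝ) / n) (atTop ⊓ 𝓟 N) (𝓝 ρ)) :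
    asympRateCDC F N r d' =
      ((4 * (max ρ (1 - ρ) * max 0 (min ρ (1 - ρ) - d' / 2)) : ℝ) : EReal) := by
  -- Infinitude of N makes the filter nontrivial, as needed to identify the limsup with the limit.
  have : (atTop ⊓ 𝓟 N).NeBot := by
    rw [← frequently_mem_iff_neBot]
    exact Nat.frequently_atTop_iff_infinite.2 hN
  refine (tendsto_rate inf_le_left (tendsto_logb_maxCDC inf_le_left ?_ hr
    ((tendsto_ceil_mul_div (by linarith)).mono_left inf_le_left))).limsup_eq
  exact mem_inf_of_right hrn

end Limits

end SubspaceCode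

theorem proposition4 {F : Type*} [Field F] [Finite F] (d' : ℝ) (hd0 : 0 ≤ d') (hd1 : d' ≤ 1) :
    SubspaceCode.asympRate F d' = ((1 - d' : ℝ) : EReal) ∧
    ∀ r' : ℝ, 0 ≤ r' → r' ≤ 1 →
      ∀ (N : Set ℕ) (r : ℕ → ℕ), N.Infinite → (∀ n ∈ N, r n ≤ n) →
        Tendsto (fun n : ℕ => (r n : ℝ) / n) (atTop ⊓ 𝓟 N) (𝓝 r') →
        ((r' ≤ d' / 2 ∨ 1 - d' / 2 ≤ r') → SubspaceCode.asympRateCDC F N r d' = 0) ∧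
        (d' / 2 ≤ r' → r' ≤ 1 / 2 →
          SubspaceCode.asympRateCDC F N r d' = ((2 * (1 - r') * (2 * r' - d') : ℝ) : EReal)) ∧
        (1 / 2 ≤ r' → r' ≤ 1 - d' / 2 →
          SubspaceCode.asympRateCDC F N r d' = ((2 * r' * (2 - 2 * r' - d') : ℝ) : EReal)) := by
  refine ⟨SubspaceCode.asympRate_eq hd0 hd1, fun r' _ _ N r hN hrn hr => ?_⟩
  rw [SubspaceCode.asympRateCDC_eq hd0 hN hrn hr]
  refine ⟨fun h => ?_, fun h1 h2 => congrArg _ ?_, fun h1 h2 => congrArg _ ?_⟩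
  · have : min r' (1 - r') - d' / 2 ≤ 0 := by
      rcases h with h | h
      · linarith [min_le_left r' (1 - r')]
      · linarith [min_le_right r' (1 - r')]
    rw [max_eq_left this]
    simp
  · rw [max_eq_right (by linarith : r' ≤ 1 - r'), min_eq_left (by linarith : r' ≤ 1 - r'),
      max_eq_right (by linarith)]
    ring
  · rw [max_eq_left (by linarith : 1 - r' ≤ r'), min_eq_right (by linarith : 1 - r' ≤ r'),
      max_eq_right (by linarith)]
    ring
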